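/- Let $f,g:\mathbb{R}^n\to\mathbb{R}^n$ be continuously differentiable, $\Delta=g-f$, $C\in\mathbb{R}^{p\times n}$, $\mu>0$, and let $M:\mathbb{R}^n\to\mathbb{R}^{p\times p}$ be differentiable with $M(x)$ symmetric positive definite for every $x$. For a positive definite matrix $N$ write $\|v\|_N=\sqrt{v^\top Nv}$. Let $x,\tilde x$ solve, for all $t\ge 0$, the systems $$\dot x=f(x),\ x(0)=x_0,\ y=Cx,\qquad \dot{\tilde x}=g(\tilde x),\ \tilde x(0)=\tilde x_0,\ \tilde y=C\tilde x,$$ and for every $s\in[0,1]$ let $\mathbf{x}(\cdot,s)$ solve, for all $t\ge 0$, the auxiliary system $$\dot{\mathbf{x}}=f(\mathbf{x})+s\Delta(\mathbf{x}),\quad \mathbf{x}(0,s)=(1-s)x_0+s\tilde x_0,\quad \mathbf{y}=C\mathbf{x}.$$ Put $M_C=C^\top MC$ and $$L(t)=\int_0^1\|\partial_s\mathbf{y}(t,s)\|_{M(\mathbf{x}(t,s))}\,ds .$$ Suppose that for all $t\ge0$ and $s\in[0,1]$ one has at $\mathbf{x}=\mathbf{x}(t,s)$ the linear matrix inequality $$\frac{\partial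 f}{\partial\mathbf{x}}^\top M_C+\dot M_C+M_C\frac{\partial f}{\partial\mathbf{x}}+s\Big(\frac{\partial\Delta}{\partial\mathbf{x}}^\top M_C+M_C\frac{\partial\Delta}{\partial\mathbf{x}}\Big)\preceq-2\mu M_C ,$$ where $\dot M_C$ is the derivative of $M_C$ along the auxiliary system, and $C\Delta(\mathbf{x})=0$. Then: 1. For every $t\ge0$ the map $s\mapsto\mathbf{y}(t,s)$ is continuously differentiable on $[0,1]$, so that $L(t)$ is well defined, and $L(t)\le e^{-\mu t}L(0)$. 2. If $N$ is a constant positive definite matrix with $N\preceq M(\mathbf{x}(t,s))$ for all $t\ge0$, $s\in[0,1]$, then $\|y(t)-\tilde y(t)\|_N\le e^{-\mu t}L(0)$ for all $t\ge0$, and the two systems become indistinguishable with respect to every positive definite matrix $P$: for each $\varepsilon>0$ there is $T>0$ such that $\|y(t)-\tilde y(t)\|_P<\varepsilon$ for all $t>T$. 3. If $M$ is constant (so that 2 applies with $N=M$), then moreover $\|y(t)-\tilde y(t)\|_M\le e^{-\mu t}\|Cx_0-C\tilde x_0\|_M$ for all $t\ge0$. -/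

import Mathlib

open scoped Matrix

noncomputable section

/-- `x` solves the initial value problem `x' = F x`, `x 0 = x₀` on `[0, ∞)`. -/
def IsSolution {n : ℕ} (F : (Fin n → ℝ) → (Fin n → ℝ)) (x₀ : Fin n → ℝ)
    (x : ℝ → (Fin n → ℝ)) : Prop :=
  x 0 = x₀ ∧ ∀ t : ℝ, 0 ≤ t → HasDerivWithinAt x (F (x t)) (Set.Ici 0) t

/-- The difference of the dynamics, `Δ(x) = g(x) - f(x)`. -/
def dynDiff {n : ℕ} (f g : (Fin n → ℝ) → (Fin n → ℝ)) (x : Fin n → ℝ) : Fin n → ℝ :=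
  g x - f x

/-- The vector field `f(x) + s Δ(x)` of the auxiliary system with parameter `s`. -/
def auxField {n : ℕ} (f g : (Fin n → ℝ) → (Fin n → ℝ)) (s : ℝ) (x : Fin n → ℝ) :
    Fin n → ℝ :=
  f x + s • dynDiff f g x

/-- `X t s` is the solution of the auxiliary system with parameter `s ∈ [0, 1]`, started at
`(1 - s) x₀ + s x₀'`. -/
def IsAuxSolution {n : ℕ} (f g : (Fin n → ℝ) → (Fin n → ℝ)) (x₀ x₀' : Fin n → ℝ)
    (X : ℝ → ℝ → (Fin n → ℝ)) : Prop :=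
  ∀ s ∈ Set.Icc (0 : ℝ) 1,
    IsSolution (auxField f g s) ((1 - s) • x₀ + s • x₀') (fun t => X t s)

/-- The weighted norm `‖v‖_M = √(vᵀ M v)`. -/
def weightedNorm {p : ℕ} (M : Matrix (Fin p) (Fin p) ℝ) (v : Fin p → ℝ) : ℝ :=
  Real.sqrt (v ⬝ᵥ (M *ᵥ v))

/-- The Jacobian matrix of `F` at `x`. -/
def jacobian {n : ℕ} (F : (Fin n → ℝ) → (Fin n → ℝ)) (x : Fin n → ℝ) :
    Matrix (Fin n) (Fin n) ℝ :=
  LinearMap.toMatrix' (fderiv ℝ F x : (Fin n → ℝ) →ₗ[ℝ] (Fin n → ℝ))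

/-- `M_C = Cᵀ M C`. -/
def pullbackMetric {n p : ℕ} (C : Matrix (Fin p) (Fin n) ℝ)
    (M : (Fin n → ℝ) → Matrix (Fin p) (Fin p) ℝ) (x : Fin n → ℝ) :
    Matrix (Fin n) (Fin n) ℝ :=
  Cᵀ * M x * C

/-- The entrywise derivative at `x`, in the direction `v`, of a matrix-valued function. For
`v` the value at `x` of a vector field, it is the time derivative along the solutions. -/
def matrixDeriv {n m : ℕ} (N : (Fin n → ℝ) → Matrix (Fin m) (Fin m) ℝ) (x v : Fin n → ℝ) :
    Matrix (Fin m) (Fin m) ℝ :=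
  Matrix.of fun i j => fderiv ℝ (fun z => N z i j) x v

/-- The contraction linear matrix inequality with rate `μ`, for the parameter `s` at the
state `x`:
`(∂f)ᵀ M_C + (d/dt) M_C + M_C ∂f + s ((∂Δ)ᵀ M_C + M_C ∂Δ) ⪯ -2 μ M_C`,
where `d/dt` is taken along the auxiliary system with parameter `s`. -/
def ContractionLMI {n p : ℕ} (f g : (Fin n → ℝ) → (Fin n → ℝ)) (C : Matrix (Fin p) (Fin n) ℝ)
    (M : (Fin n → ℝ) → Matrix (Fin p) (Fin p) ℝ) (μ s : ℝ) (x : Fin n → ℝ) : Prop :=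
  ((-2 * μ) • pullbackMetric C M x -
    ((jacobian f x)ᵀ * pullbackMetric C M x
      + matrixDeriv (pullbackMetric C M) x (auxField f g s x)
      + pullbackMetric C M x * jacobian f x
      + s • ((jacobian (dynDiff f g) x)ᵀ * pullbackMetric C M x
          + pullbackMetric C M x * jacobian (dynDiff f g) x))).PosSemidef

/-- `∂ₛ y(t, s)` for the measurement `y(t, s) = C X(t, s)`, `s ∈ [0, 1]` (one-sided at the end
points). -/
def outputTangent {n p : ℕ} (C : Matrix (Fin p) (Fin n) ℝ) (X : ℝ → ℝ → (Fin n → ℝ))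
    (t s : ℝ) : Fin p → ℝ :=
  derivWithin (fun σ => C *ᵥ X t σ) (Set.Icc 0 1) s

/-- The observed length `L(t) = ∫₀¹ ‖∂ₛ y(t, s)‖_M ds`, with `M` evaluated at `X(t, s)`. -/
def observedLength {n p : ℕ} (C : Matrix (Fin p) (Fin n) ℝ)
    (M : (Fin n → ℝ) → Matrix (Fin p) (Fin p) ℝ) (X : ℝ → ℝ → (Fin n → ℝ)) (t : ℝ) : ℝ :=
  ∫ s in (0 : ℝ)..1, weightedNorm (M (X t s)) (outputTangent C X t s)

/-- The measurements `y` and `y'` become indistinguishable with respect to `N`. -/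
def BecomeIndistinguishable {p : ℕ} (N : Matrix (Fin p) (Fin p) ℝ)
    (y y' : ℝ → (Fin p → ℝ)) : Prop :=
  ∀ ε : ℝ, 0 < ε → ∃ T : ℝ, 0 < T ∧ ∀ t : ℝ, T < t → weightedNorm N (y t - y' t) < ε

end

/-! Let `δ = ∂ₛX`. It solves the variational equation `δ' = (∂f + s ∂Δ) δ + Δ(X)`, whose forcing
term comes from the dependence of the field on `s`. For `V = δᵀ M_C δ`, the forcing enters `V'` only
through `CΔ`, which vanishes along the trajectories; the matrix inequality bounds the rest, so `V' ≤
-2μV`. Hence `‖∂ₛy‖_M = √V` decays like `e^{-μt}` for each `s` (`weightedNorm_tangent_le`), and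
integration over `s` gives the decay of `L`. By uniqueness the curve `s ↦ y(t, s)` joins `y(t)` to
`ỹ(t)`, so their `N`-distance is at most its length (`weightedNorm_sub_le_integral`). For constant
`M` the initial curve is a segment, whose length is the distance of its end points.

The analytic work is the existence of `δ`, one-sided at `s = 0, 1`, since solutions are given only
for `s ∈ [0, 1]`. Adjoining `s` to the state gives an autonomous `C¹` field with initial values
affine in `s`. Difference quotients in `s` then solve the variational equation up to a small error,
all with the same initial value, and Grönwall's inequality makes them uniformly Cauchy on `[0, T]`.
-/

/-! ### Differentiability of solutions in a parameter: estimates for difference quotients. -/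

section Flow

open Set Filter Topology Metric

variable {E : Type*} [NormedAddCommGroup E] [NormedSpace ℝ E]

/-- A `C¹` map is strictly differentiable uniformly along a compact set. -/
theorem ContDiff.exists_forall_ball_norm_sub_le {H : E → E} (hH : ContDiff ℝ 1 H) {K : Set E}
    (hK : IsCompact K) {ε : ℝ} (hε : 0 < ε) :
    ∃ η > 0, ∀ z ∈ K, ∀ u ∈ ball z η, ∀ v ∈ ball z η,
      ‖H u - H v - fderiv ℝ H z (u - v)‖ ≤ ε * ‖u - v‖ := by
  have hD : Continuous (fderiv ℝ H) := hH.continuous_fderiv one_ne_zero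
  -- Only one of the two points compared has to lie in `K`, so the estimate covers whole balls,
  -- where the mean value inequality applies.
  have h := hK.uniformContinuousAt_of_continuousAt (fderiv ℝ H) (fun a _ => hD.continuousAt)
    (dist_mem_uniformity hε)
  obtain ⟨η, hη, hη'⟩ := mem_uniformity_dist.1 h
  refine ⟨η, hη, fun z hz u hu v hv => ?_⟩
  refine (convex_ball z η).norm_image_sub_le_of_norm_fderiv_le'
    (fun w _ => (hH.differentiable one_ne_zero) w) (fun w hw => ?_) hv hu
  have := hη' (a := z) (b := w) (by rwa [dist_comm]) hz
  rw [← dist_eq_norm, dist_comm]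
  exact le_of_lt this

/-- A `C¹` map is uniformly Lipschitz on the balls of a fixed radius around a compact set, with a
constant that also bounds its derivative. -/
theorem ContDiff.exists_forall_ball_lipschitzOnWith {H : E → E} (hH : ContDiff ℝ 1 H) {K : Set E}
    (hK : IsCompact K) :
    ∃ η > 0, ∃ L : NNReal, ∀ z ∈ K, ‖fderiv ℝ H z‖ ≤ L ∧ LipschitzOnWith L H (ball z η) := by
  obtain ⟨η, hη, h⟩ := hH.exists_forall_ball_norm_sub_le hK one_pos
  obtain ⟨B, hB⟩ := (hK.image (hH.continuous_fderiv one_ne_zero)).isBounded.exists_norm_le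
  -- The `1` is the linearisation error on the ball; the maximum with `0` covers an empty `K`.
  refine ⟨η, hη, Real.toNNReal (1 + max B 0), fun z hz => ?_⟩
  have hz' : ‖fderiv ℝ H z‖ ≤ max B 0 := (hB _ ⟨z, hz, rfl⟩).trans (le_max_left _ _)
  have hc : ((Real.toNNReal (1 + max B 0) : NNReal) : ℝ) = 1 + max B 0 :=
    Real.coe_toNNReal _ (by positivity)
  refine ⟨by rw [hc]; linarith, LipschitzOnWith.of_dist_le_mul fun u hu v hv => ?_⟩
  rw [hc, dist_eq_norm, dist_eq_norm]
  have h1 := h z hz u hu v hv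
  have h2 := (fderiv ℝ H z).le_opNorm (u - v)
  have h3 : ‖H u - H v‖ ≤ ‖H u - H v - fderiv ℝ H z (u - v)‖ + ‖fderiv ℝ H z (u - v)‖ := by
    simpa using norm_add_le (H u - H v - fderiv ℝ H z (u - v)) (fderiv ℝ H z (u - v))
  have h4 := mul_le_mul_of_nonneg_right hz' (norm_nonneg (u - v))
  linarith

/-- `Z · s`, for `s ∈ S`, are solutions on `[0, ∞)` of `z' = H z` whose initial values depend
affinely on `s`. -/
structure IsSolutionFamily (H : E → E) (S : Set ℝ) (a b : E) (Z : ℝ → ℝ → E) : Prop where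
  deriv : ∀ s ∈ S, ∀ t, 0 ≤ t → HasDerivWithinAt (Z · s) (H (Z t s)) (Ici 0) t
  init : ∀ s ∈ S, Z 0 s = a + s • b

namespace IsSolutionFamily

variable {H : E → E} {S : Set ℝ} {a b : E} {Z : ℝ → ℝ → E} {s₀ : ℝ} {T : ℝ}

theorem continuousOn (h : IsSolutionFamily H S a b Z) {s : ℝ} (hs : s ∈ S) (T : ℝ) :
    ContinuousOn (Z · s) (Icc 0 T) := fun t ht =>
  ((h.deriv s hs t ht.1).continuousWithinAt).mono Icc_subset_Ici_self

theorem deriv_right (h : IsSolutionFamily H S a b Z) {s : ℝ} (hs : s ∈ S) {t : ℝ} (ht : 0 ≤ t) :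
    HasDerivWithinAt (Z · s) (H (Z t s)) (Ici t) t :=
  (h.deriv s hs t ht).mono (Ici_subset_Ici.2 ht)

theorem dist_init (h : IsSolutionFamily H S a b Z) {s₁ s₂ : ℝ} (hs₁ : s₁ ∈ S) (hs₂ : s₂ ∈ S) :
    dist (Z 0 s₁) (Z 0 s₂) = |s₁ - s₂| * ‖b‖ := by
  rw [h.init _ hs₁, h.init _ hs₂, dist_eq_norm, add_sub_add_left_eq_sub, ← sub_smul, norm_smul,
    Real.norm_eq_abs]

/-- Solutions that stay, on `[0, τ)`, in a tube on which the field is Lipschitz, depend Lipschitz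
continuously on the parameter. -/
theorem dist_le_of_mem_tube (h : IsSolutionFamily H S a b Z) {c : ℝ → E} {η : ℝ} {L : NNReal}
    {τ : ℝ} (hL : ∀ t ∈ Ico 0 τ, LipschitzOnWith L H (ball (c t) η)) {s₁ s₂ : ℝ}
    (hs₁ : s₁ ∈ S) (hs₂ : s₂ ∈ S) (h₁ : ∀ t ∈ Ico 0 τ, Z t s₁ ∈ ball (c t) η)
    (h₂ : ∀ t ∈ Ico 0 τ, Z t s₂ ∈ ball (c t) η) {t : ℝ} (ht : t ∈ Icc 0 τ) :
    dist (Z t s₁) (Z t s₂) ≤ |s₁ - s₂| * ‖b‖ * Real.exp (L * t) := by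
  have := dist_le_of_trajectories_ODE_of_mem (v := fun _ => H) hL (h.continuousOn hs₁ τ)
    (fun t ht => h.deriv_right hs₁ ht.1) h₁ (h.continuousOn hs₂ τ)
    (fun t ht => h.deriv_right hs₂ ht.1) h₂ (h.dist_init hs₁ hs₂).le t ht
  simpa using this

/-- Continuous dependence on the parameter, uniformly on `[0, T]`. -/
theorem exists_forall_dist_lt (h : IsSolutionFamily H S a b Z) (hH : ContDiff ℝ 1 H)
    (hs₀ : s₀ ∈ S) (T : ℝ) {η : ℝ} (hη : 0 < η) :
    ∃ ρ > 0, ∀ s ∈ S ∩ ball s₀ ρ, ∀ t ∈ Icc 0 T, Z t s ∈ ball (Z t s₀) η := by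
  have hK : IsCompact ((Z · s₀) '' Icc 0 T) := isCompact_Icc.image_of_continuousOn
    (h.continuousOn hs₀ T)
  obtain ⟨η₁, hη₁, L, hL⟩ := hH.exists_forall_ball_lipschitzOnWith hK
  set r := min η η₁ with hr
  have hr0 : 0 < r := lt_min hη hη₁
  -- `‖b‖ + 1` keeps `B` positive when `b = 0`.
  set B := (‖b‖ + 1) * Real.exp (L * T) with hB
  have hB0 : 0 < B := by positivity
  refine ⟨r / B, by positivity, fun s hs t ht => ?_⟩
  suffices hlt : dist (Z t s) (Z t s₀) < r from lt_of_lt_of_le hlt (min_le_left _ _)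
  by_contra hcon
  have hφ : ContinuousOn (fun t => dist (Z t s) (Z t s₀)) (Icc 0 T) :=
    continuous_dist.comp_continuousOn ((h.continuousOn hs.1 T).prodMk (h.continuousOn hs₀ T))
  have hcl : IsCompact (Icc 0 T ∩ (fun t => dist (Z t s) (Z t s₀)) ⁻¹' Ici r) :=
    isCompact_Icc.of_isClosed_subset (hφ.preimage_isClosed_of_isClosed isClosed_Icc isClosed_Ici)
      inter_subset_left
  -- `τ` is the first exit time from the tube of radius `r`. The Lipschitz estimate needs the tube
  -- only before `τ` but holds at `τ` too, where it gives a distance below `r`.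
  obtain ⟨τ, ⟨hτ, hτr⟩, hmin⟩ := hcl.exists_isLeast ⟨t, ht, not_lt.1 hcon⟩
  have hin : ∀ t ∈ Ico 0 τ, Z t s ∈ ball (Z t s₀) r := by
    intro u hu
    by_contra hu'
    exact absurd (hmin ⟨⟨hu.1, hu.2.le.trans hτ.2⟩, (not_lt.1 hu' : r ≤ dist (Z u s) (Z u s₀))⟩) (not_le.2 hu.2)
  have hle := h.dist_le_of_mem_tube (c := (Z · s₀)) (η := r) (L := L) (τ := τ)
    (fun u hu => ((hL _ ⟨u, ⟨hu.1, hu.2.le.trans hτ.2⟩, rfl⟩).2).mono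
      (ball_subset_ball (min_le_right _ _))) hs.1 hs₀ hin
    (fun u _ => mem_ball_self hr0) (right_mem_Icc.2 hτ.1)
  have hsr : |s - s₀| < r / B := hs.2
  have hexp : Real.exp (L * τ) ≤ Real.exp (L * T) :=
    Real.exp_le_exp.2 (mul_le_mul_of_nonneg_left hτ.2 L.2)
  have hlt : |s - s₀| * ‖b‖ * Real.exp (L * τ) < r := by
    calc |s - s₀| * ‖b‖ * Real.exp (L * τ) ≤ |s - s₀| * (‖b‖ + 1) * Real.exp (L * T) := by
          gcongr; linarith
      _ = |s - s₀| * B := by rw [hB]; ring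
      _ < r / B * B := by gcongr
      _ = r := div_mul_cancel₀ _ hB0.ne'
  exact absurd (hle.trans_lt hlt) (not_lt.2 hτr)

/-- The difference quotients in the parameter solve the variational equation up to a small error. -/
theorem exists_forall_slope_deriv (h : IsSolutionFamily H S a b Z) (hH : ContDiff ℝ 1 H)
    (hs₀ : s₀ ∈ S) (T : ℝ) {ε : ℝ} (hε : 0 < ε) :
    ∃ ρ > 0, ∀ s₁ ∈ S ∩ ball s₀ ρ, ∀ s₂ ∈ S ∩ ball s₀ ρ, s₁ ≠ s₂ → ∀ t ∈ Icc 0 T,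
      HasDerivWithinAt (fun t => slope (Z t) s₁ s₂) (slope (fun s => H (Z t s)) s₁ s₂) (Ici 0) t ∧
      ‖slope (fun s => H (Z t s)) s₁ s₂ - fderiv ℝ H (Z t s₀) (slope (Z t) s₁ s₂)‖ ≤ ε := by
  have hK : IsCompact ((Z · s₀) '' Icc 0 T) := isCompact_Icc.image_of_continuousOn
    (h.continuousOn hs₀ T)
  obtain ⟨η₁, hη₁, L, hL⟩ := hH.exists_forall_ball_lipschitzOnWith hK
  set B := (‖b‖ + 1) * Real.exp (L * T) with hB
  have hB0 : 0 < B := by positivity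
  -- Solutions are `B`-Lipschitz in the parameter near `s₀`, so a linearisation error `ε / B`
  -- becomes `ε` for the quotient.
  obtain ⟨η₂, hη₂, hD⟩ := hH.exists_forall_ball_norm_sub_le hK (div_pos hε hB0)
  obtain ⟨ρ₁, hρ₁, hZ₁⟩ := h.exists_forall_dist_lt hH hs₀ T hη₁
  obtain ⟨ρ₂, hρ₂, hZ₂⟩ := h.exists_forall_dist_lt hH hs₀ T hη₂
  refine ⟨min ρ₁ ρ₂, lt_min hρ₁ hρ₂, fun s₁ hs₁ s₂ hs₂ hne t ht => ⟨?_, ?_⟩⟩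
  · simp only [slope_def_module]
    exact ((h.deriv s₂ hs₂.1 t ht.1).sub (h.deriv s₁ hs₁.1 t ht.1)).const_smul _
  · have hmem : ∀ s ∈ S ∩ ball s₀ (min ρ₁ ρ₂), s ∈ S ∩ ball s₀ ρ₁ ∧ s ∈ S ∩ ball s₀ ρ₂ :=
      fun s hs => ⟨⟨hs.1, ball_subset_ball (min_le_left _ _) hs.2⟩,
        ⟨hs.1, ball_subset_ball (min_le_right _ _) hs.2⟩⟩
    have hd := h.dist_le_of_mem_tube (c := (Z · s₀)) (η := η₁) (L := L) (τ := T)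
      (fun u hu => (hL _ ⟨u, Ico_subset_Icc_self hu, rfl⟩).2) hs₂.1 hs₁.1
      (fun u hu => hZ₁ _ (hmem _ hs₂).1 u (Ico_subset_Icc_self hu))
      (fun u hu => hZ₁ _ (hmem _ hs₁).1 u (Ico_subset_Icc_self hu)) ht
    have hlin := hD (Z t s₀) ⟨t, ht, rfl⟩ _ (hZ₂ _ (hmem _ hs₂).2 t ht) _
      (hZ₂ _ (hmem _ hs₁).2 t ht)
    have hpos : 0 < |s₂ - s₁| := abs_pos.2 (sub_ne_zero.2 hne.symm)
    rw [slope_def_module, slope_def_module, map_smul, ← smul_sub, norm_smul, norm_inv,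
      Real.norm_eq_abs, inv_mul_le_iff₀ hpos]
    refine hlin.trans ?_
    have hexp : Real.exp (L * t) ≤ Real.exp (L * T) :=
      Real.exp_le_exp.2 (mul_le_mul_of_nonneg_left ht.2 L.2)
    have hd' : ‖Z t s₂ - Z t s₁‖ ≤ |s₂ - s₁| * B := by
      rw [← dist_eq_norm, hB, ← mul_assoc]
      refine hd.trans ?_
      gcongr
      linarith
    calc ε / B * ‖Z t s₂ - Z t s₁‖ ≤ ε / B * (|s₂ - s₁| * B) := by gcongr
      _ = |s₂ - s₁| * ε := by field_simp

/-- The difference quotients in the parameter are uniformly Cauchy on `[0, T]`. -/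
theorem exists_forall_dist_slope_le (h : IsSolutionFamily H S a b Z) (hH : ContDiff ℝ 1 H)
    (hs₀ : s₀ ∈ S) (T : ℝ) {ε : ℝ} (hε : 0 < ε) :
    ∃ ρ > 0, ∀ s₁ ∈ S ∩ ball s₀ ρ, ∀ s₂ ∈ S ∩ ball s₀ ρ, s₁ ≠ s₂ →
      ∀ s₃ ∈ S ∩ ball s₀ ρ, ∀ s₄ ∈ S ∩ ball s₀ ρ, s₃ ≠ s₄ → ∀ t ∈ Icc 0 T,
        dist (slope (Z t) s₁ s₂) (slope (Z t) s₃ s₄) ≤ ε := by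
  have hK : IsCompact ((Z · s₀) '' Icc 0 T) := isCompact_Icc.image_of_continuousOn
    (h.continuousOn hs₀ T)
  obtain ⟨_, _, L, hL⟩ := hH.exists_forall_ball_lipschitzOnWith hK
  -- Two approximate solutions with error `κ` each and no initial gap; their Grönwall bound vanishes
  -- as `κ → 0`.
  obtain ⟨κ, hκ, hκε⟩ : ∃ κ > 0, gronwallBound 0 L (κ + κ) T ≤ ε := by
    have hcont : Continuous fun κ : ℝ => gronwallBound 0 L (κ + κ) T :=
      (gronwallBound_continuous_ε 0 L T).comp (continuous_id.add continuous_id)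
    have hlim : Tendsto (fun κ : ℝ => gronwallBound 0 L (κ + κ) T) (𝓝[>] 0) (𝓝 0) := by
      have := hcont.tendsto 0
      simp only [add_zero, gronwallBound_ε0_δ0] at this
      exact this.mono_left nhdsWithin_le_nhds
    obtain ⟨κ, h1, h2⟩ := ((hlim.eventually (ge_mem_nhds hε)).and self_mem_nhdsWithin).exists
    exact ⟨κ, h2, h1⟩
  obtain ⟨ρ, hρ, hq⟩ := h.exists_forall_slope_deriv hH hs₀ T hκ
  refine ⟨ρ, hρ, fun s₁ hs₁ s₂ hs₂ h₁₂ s₃ hs₃ s₄ hs₄ h₃₄ t ht => ?_⟩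
  -- Affine initial values make every initial difference quotient equal to `b`.
  have hinit : ∀ s₁ ∈ S, ∀ s₂ ∈ S, s₁ ≠ s₂ → slope (Z 0) s₁ s₂ = b := by
    intro s₁ hs₁ s₂ hs₂ hne
    rw [slope_def_module, h.init _ hs₁, h.init _ hs₂, add_sub_add_left_eq_sub, ← sub_smul,
      inv_smul_smul₀ (sub_ne_zero.2 hne.symm)]
  have key := dist_le_of_approx_trajectories_ODE_of_mem (v := fun t => fderiv ℝ H (Z t s₀))
    (s := fun _ => univ) (K := L) (a := 0) (b := T) (δ := 0) (εf := κ) (εg := κ)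
    (f := fun t => slope (Z t) s₁ s₂) (g := fun t => slope (Z t) s₃ s₄)
    (f' := fun t => slope (fun s => H (Z t s)) s₁ s₂)
    (g' := fun t => slope (fun s => H (Z t s)) s₃ s₄)
    (fun u hu => (((fderiv ℝ H (Z u s₀)).lipschitz.weaken
      (hL _ ⟨u, Ico_subset_Icc_self hu, rfl⟩).1).lipschitzOnWith))
    (fun u hu => ((hq _ hs₁ _ hs₂ h₁₂ u hu).1.continuousWithinAt).mono Icc_subset_Ici_self)
    (fun u hu => (hq _ hs₁ _ hs₂ h₁₂ u (Ico_subset_Icc_self hu)).1.mono (Ici_subset_Ici.2 hu.1))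
    (fun u hu => by
      rw [dist_eq_norm]; exact (hq _ hs₁ _ hs₂ h₁₂ u (Ico_subset_Icc_self hu)).2)
    (fun _ _ => mem_univ _)
    (fun u hu => ((hq _ hs₃ _ hs₄ h₃₄ u hu).1.continuousWithinAt).mono Icc_subset_Ici_self)
    (fun u hu => (hq _ hs₃ _ hs₄ h₃₄ u (Ico_subset_Icc_self hu)).1.mono (Ici_subset_Ici.2 hu.1))
    (fun u hu => by
      rw [dist_eq_norm]; exact (hq _ hs₃ _ hs₄ h₃₄ u (Ico_subset_Icc_self hu)).2)
    (fun _ _ => mem_univ _)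
    (by rw [hinit _ hs₁.1 _ hs₂.1 h₁₂, hinit _ hs₃.1 _ hs₄.1 h₃₄, dist_self]) t ht
  refine key.trans (le_trans ?_ hκε)
  exact gronwallBound_mono le_rfl (by positivity) L.2 (by simpa using ht.2)

/-! ### The derivative in the parameter and the variational equation. -/

variable [CompleteSpace E]

/-- The slopes based at `s₀` are Cauchy, so completeness supplies a limit. Unique differentiability
makes `s₀` an accumulation point of `S`. -/
theorem hasDerivWithinAt_param (h : IsSolutionFamily H S a b Z) (hH : ContDiff ℝ 1 H)
    (hS : UniqueDiffOn ℝ S) (hs₀ : s₀ ∈ S) {t : ℝ} (ht : 0 ≤ t) :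
    HasDerivWithinAt (Z t) (derivWithin (Z t) S s₀) S s₀ := by
  have hne : (𝓝[S \ {s₀}] s₀).NeBot :=
    accPt_principal_iff_nhdsWithin.1 (uniqueDiffWithinAt_iff_accPt.1 (hS s₀ hs₀))
  suffices hex : ∃ v, HasDerivWithinAt (Z t) v S s₀ from
    hex.choose_spec.differentiableWithinAt.hasDerivWithinAt
  simp only [hasDerivWithinAt_iff_tendsto_slope]
  refine cauchy_map_iff_exists_tendsto.1 (Metric.cauchy_iff.2 ⟨inferInstance, fun ε hε => ?_⟩)
  obtain ⟨ρ, hρ, hq⟩ := h.exists_forall_dist_slope_le hH hs₀ t (half_pos hε)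
  refine ⟨slope (Z t) s₀ '' ((S \ {s₀}) ∩ ball s₀ ρ),
    image_mem_map (inter_mem self_mem_nhdsWithin
      (mem_nhdsWithin_of_mem_nhds (ball_mem_nhds _ hρ))), ?_⟩
  rintro _ ⟨s₁, hs₁, rfl⟩ _ ⟨s₂, hs₂, rfl⟩
  have h0 : s₀ ∈ S ∩ ball s₀ ρ := ⟨hs₀, mem_ball_self hρ⟩
  exact (hq _ h0 _ ⟨hs₁.1.1, hs₁.2⟩ (Ne.symm hs₁.1.2) _ h0 _ ⟨hs₂.1.1, hs₂.2⟩ (Ne.symm hs₂.1.2) t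
    ⟨ht, le_rfl⟩).trans_lt (half_lt_self hε)

/-- The solutions are strictly differentiable in the parameter, uniformly on `[0, T]`. -/
theorem exists_forall_dist_slope_derivWithin_le (h : IsSolutionFamily H S a b Z)
    (hH : ContDiff ℝ 1 H) (hS : UniqueDiffOn ℝ S) (hs₀ : s₀ ∈ S) (T : ℝ) {ε : ℝ} (hε : 0 < ε) :
    ∃ ρ > 0, ∀ s₁ ∈ S ∩ ball s₀ ρ, ∀ s₂ ∈ S ∩ ball s₀ ρ, s₁ ≠ s₂ → ∀ t ∈ Icc 0 T,
        dist (slope (Z t) s₁ s₂) (derivWithin (Z t) S s₀) ≤ ε := by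
  have hne : (𝓝[S \ {s₀}] s₀).NeBot :=
    accPt_principal_iff_nhdsWithin.1 (uniqueDiffWithinAt_iff_accPt.1 (hS s₀ hs₀))
  obtain ⟨ρ, hρ, hq⟩ := h.exists_forall_dist_slope_le hH hs₀ T hε
  refine ⟨ρ, hρ, fun s₁ hs₁ s₂ hs₂ h₁₂ t ht => ?_⟩
  have hlim := hasDerivWithinAt_iff_tendsto_slope.1 (h.hasDerivWithinAt_param hH hS hs₀ ht.1)
  -- The second pair in the Cauchy estimate is `(s₀, s)`, and `s → s₀`.
  refine le_of_tendsto (tendsto_const_nhds.dist hlim) ?_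
  filter_upwards [self_mem_nhdsWithin, mem_nhdsWithin_of_mem_nhds (ball_mem_nhds s₀ hρ)]
    with s hs hs'
  exact hq _ hs₁ _ hs₂ h₁₂ _ ⟨hs₀, mem_ball_self hρ⟩ _ ⟨hs.1, hs'⟩ (Ne.symm hs.2) t ht

/-- For `s` near `s₀`, slopes based at `s` are close to the derivative at `s₀` by strict
differentiability; their limit is the derivative at `s`. -/
theorem continuousOn_derivWithin (h : IsSolutionFamily H S a b Z) (hH : ContDiff ℝ 1 H)
    (hS : UniqueDiffOn ℝ S) {t : ℝ} (ht : 0 ≤ t) : ContinuousOn (derivWithin (Z t) S) S := by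
  intro s₀ hs₀
  refine Metric.continuousWithinAt_iff.2 fun ε hε => ?_
  obtain ⟨ρ, hρ, hq⟩ := h.exists_forall_dist_slope_derivWithin_le hH hS hs₀ t (half_pos hε)
  refine ⟨ρ, hρ, fun {s} hs hsρ => lt_of_le_of_lt ?_ (half_lt_self hε)⟩
  have hne : (𝓝[S \ {s}] s).NeBot :=
    accPt_principal_iff_nhdsWithin.1 (uniqueDiffWithinAt_iff_accPt.1 (hS s hs))
  have hlim := hasDerivWithinAt_iff_tendsto_slope.1 (h.hasDerivWithinAt_param hH hS hs ht)
  refine le_of_tendsto (hlim.dist tendsto_const_nhds) ?_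
  filter_upwards [self_mem_nhdsWithin,
    mem_nhdsWithin_of_mem_nhds (isOpen_ball.mem_nhds (mem_ball.2 hsρ))] with s' hs' hs''
  exact hq _ ⟨hs, hsρ⟩ _ ⟨hs'.1, hs''⟩ (Ne.symm hs'.2) t ⟨ht, le_rfl⟩

theorem tendstoUniformlyOn_slope (h : IsSolutionFamily H S a b Z) (hH : ContDiff ℝ 1 H)
    (hS : UniqueDiffOn ℝ S) (hs₀ : s₀ ∈ S) (T : ℝ) :
    TendstoUniformlyOn (fun s t => slope (Z t) s₀ s) (fun t => derivWithin (Z t) S s₀)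
      (𝓝[S \ {s₀}] s₀) (Icc 0 T) := by
  refine Metric.tendstoUniformlyOn_iff.2 fun ε hε => ?_
  obtain ⟨ρ, hρ, hq⟩ := h.exists_forall_dist_slope_derivWithin_le hH hS hs₀ T (half_pos hε)
  filter_upwards [self_mem_nhdsWithin, mem_nhdsWithin_of_mem_nhds (ball_mem_nhds s₀ hρ)]
    with s hs hs' t ht
  rw [dist_comm]
  exact (hq _ ⟨hs₀, mem_ball_self hρ⟩ _ ⟨hs.1, hs'⟩ (Ne.symm hs.2) t ht).trans_lt
    (half_lt_self hε)

theorem continuousOn_variation (h : IsSolutionFamily H S a b Z) (hH : ContDiff ℝ 1 H)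
    (hS : UniqueDiffOn ℝ S) (hs₀ : s₀ ∈ S) (T : ℝ) :
    ContinuousOn (fun t => derivWithin (Z t) S s₀) (Icc 0 T) := by
  have hne : (𝓝[S \ {s₀}] s₀).NeBot :=
    accPt_principal_iff_nhdsWithin.1 (uniqueDiffWithinAt_iff_accPt.1 (hS s₀ hs₀))
  refine (h.tendstoUniformlyOn_slope hH hS hs₀ T).continuousOn (Eventually.frequently ?_)
  filter_upwards [self_mem_nhdsWithin] with s hs
  simp only [slope_def_module]
  exact ((h.continuousOn hs.1 T).sub (h.continuousOn hs₀ T)).const_smul _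

/-- The derivative in the parameter solves the variational equation. -/
theorem hasDerivAt_variation (h : IsSolutionFamily H S a b Z) (hH : ContDiff ℝ 1 H)
    (hS : UniqueDiffOn ℝ S) (hs₀ : s₀ ∈ S) {t : ℝ} (ht : 0 < t) :
    HasDerivAt (fun t => derivWithin (Z t) S s₀)
      (fderiv ℝ H (Z t s₀) (derivWithin (Z t) S s₀)) t := by
  have hne : (𝓝[S \ {s₀}] s₀).NeBot :=
    accPt_principal_iff_nhdsWithin.1 (uniqueDiffWithinAt_iff_accPt.1 (hS s₀ hs₀))
  -- Puts `t` inside the open interval `(0, T)`, where slopes and their time derivatives both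
  -- converge uniformly.
  set T := t + 1 with hT
  have hK : IsCompact ((Z · s₀) '' Icc 0 T) := isCompact_Icc.image_of_continuousOn
    (h.continuousOn hs₀ T)
  obtain ⟨_, _, L, hL⟩ := hH.exists_forall_ball_lipschitzOnWith hK
  have hunif := h.tendstoUniformlyOn_slope hH hS hs₀ T
  refine hasDerivAt_of_tendstoUniformlyOn (s := Ioo 0 T) (l := 𝓝[S \ {s₀}] s₀) isOpen_Ioo
    (f := fun s t => slope (Z t) s₀ s)
    (f' := fun s t => slope (fun s => H (Z t s)) s₀ s)
    (g' := fun t => fderiv ℝ H (Z t s₀) (derivWithin (Z t) S s₀)) ?_ ?_ ?_ ⟨ht, by linarith⟩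
  · refine Metric.tendstoUniformlyOn_iff.2 fun ε hε => ?_
    obtain ⟨ρ, hρ, hq⟩ := h.exists_forall_slope_deriv hH hs₀ T (half_pos hε)
    -- `L` bounds the derivative of `H` along the trajectory; `L + 1` avoids dividing by zero.
    have hκ : 0 < ε / 2 / (L + 1) := by positivity
    filter_upwards [Metric.tendstoUniformlyOn_iff.1 hunif _ hκ, self_mem_nhdsWithin,
      mem_nhdsWithin_of_mem_nhds (ball_mem_nhds s₀ hρ)] with s h1 hs hs' u hu
    have hu' := Ioo_subset_Icc_self hu
    have h2 := (hq _ ⟨hs₀, mem_ball_self hρ⟩ _ ⟨hs.1, hs'⟩ (Ne.symm hs.2) u hu').2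
    have h3 := h1 u hu'
    have h4 := (fderiv ℝ H (Z u s₀)).le_of_opNorm_le (hL _ ⟨u, hu', rfl⟩).1
      (derivWithin (Z u) S s₀ - slope (Z u) s₀ s)
    rw [← dist_eq_norm, map_sub, ← dist_eq_norm] at h4
    rw [← dist_eq_norm] at h2
    have h5 : (L : ℝ) * dist (derivWithin (Z u) S s₀) (slope (Z u) s₀ s) ≤
        L * (ε / 2 / (L + 1)) := by gcongr
    have h6 : (L : ℝ) * (ε / 2 / (L + 1)) < ε / 2 := by
      rw [mul_div_assoc', div_lt_iff₀ (by positivity)]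
      nlinarith
    rw [dist_comm] at h2
    have := dist_triangle (fderiv ℝ H (Z u s₀) (derivWithin (Z u) S s₀))
      (fderiv ℝ H (Z u s₀) (slope (Z u) s₀ s)) (slope (fun s => H (Z u s)) s₀ s)
    linarith
  · filter_upwards [self_mem_nhdsWithin] with s hs u hu
    have hmem : Ici (0 : ℝ) ∈ 𝓝 u := Ici_mem_nhds hu.1
    simp only [slope_def_module]
    exact ((((h.deriv s hs.1 u hu.1.le).hasDerivAt hmem)).sub
      (((h.deriv s₀ hs₀ u hu.1.le).hasDerivAt hmem))).const_smul _
  · intro u hu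
    exact hasDerivWithinAt_iff_tendsto_slope.1 (h.hasDerivWithinAt_param hH hS hs₀ hu.1.le)

end IsSolutionFamily

end Flow

/-! ### The auxiliary system as a solution family on the extended state space. -/

section Auxiliary

open Set Topology

variable {n p : ℕ} {f g : (Fin n → ℝ) → (Fin n → ℝ)} {x₀ x₀' : Fin n → ℝ}
  {X : ℝ → ℝ → (Fin n → ℝ)}

theorem contDiff_dynDiff (hf : ContDiff ℝ 1 f) (hg : ContDiff ℝ 1 g) :
    ContDiff ℝ 1 (dynDiff f g) :=
  hg.sub hf

/-- The auxiliary system, with the parameter as an additional constant state. -/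
def extendedField (f g : (Fin n → ℝ) → (Fin n → ℝ)) (z : ℝ × (Fin n → ℝ)) :
    ℝ × (Fin n → ℝ) :=
  (0, auxField f g z.1 z.2)

theorem contDiff_extendedField (hf : ContDiff ℝ 1 f) (hg : ContDiff ℝ 1 g) :
    ContDiff ℝ 1 (extendedField f g) :=
  contDiff_const.prodMk ((hf.comp contDiff_snd).add
    (contDiff_fst.smul ((contDiff_dynDiff hf hg).comp contDiff_snd)))

/-- The unit parameter component of the tangent vector produces the forcing term `Δ(x)`. -/
theorem fderiv_extendedField (hf : ContDiff ℝ 1 f) (hg : ContDiff ℝ 1 g) (s : ℝ)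
    (x v : Fin n → ℝ) :
    (fderiv ℝ (extendedField f g) (s, x) (1, v)).2 =
      fderiv ℝ f x v + s • fderiv ℝ (dynDiff f g) x v + dynDiff f g x := by
  have h₁ := ((hf.differentiable one_ne_zero) x).hasFDerivAt
  have h₂ := (((contDiff_dynDiff hf hg).differentiable one_ne_zero) x).hasFDerivAt
  have hs : HasFDerivAt Prod.snd
      (ContinuousLinearMap.snd ℝ ℝ (Fin n → ℝ)) (s, x) := hasFDerivAt_snd
  have ht : HasFDerivAt Prod.fst
      (ContinuousLinearMap.fst ℝ ℝ (Fin n → ℝ)) (s, x) := hasFDerivAt_fst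
  have h : HasFDerivAt (extendedField f g) _ (s, x) :=
    (hasFDerivAt_const (0 : ℝ) (s, x)).prodMk
      ((HasFDerivAt.comp (s, x) (f := Prod.snd) h₁ hs).add
        (ht.smul (HasFDerivAt.comp (s, x) (f := Prod.snd) h₂ hs)))
  rw [h.fderiv]
  simp [add_assoc]

theorem IsAuxSolution.isSolutionFamily (hX : IsAuxSolution f g x₀ x₀' X) :
    IsSolutionFamily (extendedField f g) (Icc 0 1) (0, x₀) (1, x₀' - x₀)
      (fun t s => (s, X t s)) where
  deriv s hs t ht := (hasDerivWithinAt_const t (Ici 0) s).prodMk ((hX s hs).2 t ht)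
  init s hs := by
    have h : X 0 s = (1 - s) • x₀ + s • x₀' := (hX s hs).1
    rw [h]
    ext i
    · simp
    · simp; ring

/-- The solutions of the auxiliary system are continuously differentiable in the parameter, and
the derivative solves the variational equation. -/
theorem IsAuxSolution.exists_tangent (hf : ContDiff ℝ 1 f) (hg : ContDiff ℝ 1 g)
    (hX : IsAuxSolution f g x₀ x₀' X) :
    ∃ δ : ℝ → ℝ → (Fin n → ℝ),
      (∀ t, 0 ≤ t → ∀ s ∈ Icc (0 : ℝ) 1, HasDerivWithinAt (X t) (δ t s) (Icc 0 1) s) ∧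
      (∀ t, 0 ≤ t → ContinuousOn (δ t) (Icc 0 1)) ∧
      (∀ s ∈ Icc (0 : ℝ) 1, ∀ T, ContinuousOn (δ · s) (Icc 0 T)) ∧
      ∀ s ∈ Icc (0 : ℝ) 1, ∀ t, 0 < t → HasDerivAt (δ · s)
        (fderiv ℝ f (X t s) (δ t s) + s • fderiv ℝ (dynDiff f g) (X t s) (δ t s)
          + dynDiff f g (X t s)) t := by
  have hH := contDiff_extendedField hf hg
  have h := hX.isSolutionFamily
  have hI : UniqueDiffOn ℝ (Icc (0 : ℝ) 1) := uniqueDiffOn_Icc one_pos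
  set D : ℝ → ℝ → ℝ × (Fin n → ℝ) := fun t s => derivWithin (fun s => (s, X t s)) (Icc 0 1) s
    with hD
  have hderiv : ∀ t, 0 ≤ t → ∀ s ∈ Icc (0 : ℝ) 1,
      HasDerivWithinAt (fun s => (s, X t s)) (D t s) (Icc 0 1) s :=
    fun t ht s hs => h.hasDerivWithinAt_param hH hI hs ht
  have hfst : ∀ t, 0 ≤ t → ∀ s ∈ Icc (0 : ℝ) 1, (D t s).1 = 1 := by
    intro t ht s hs
    have h1 : HasDerivWithinAt (fun s : ℝ => s) (D t s).1 (Icc 0 1) s := (hderiv t ht s hs).fst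
    exact (hI s hs).eq_deriv _ h1 (hasDerivWithinAt_id s _)
  refine ⟨fun t s => (D t s).2, fun t ht s hs => (hderiv t ht s hs).snd,
    fun t ht => continuous_snd.comp_continuousOn (h.continuousOn_derivWithin hH hI ht),
    fun s hs T => continuous_snd.comp_continuousOn (h.continuousOn_variation hH hI hs T),
    fun s hs t ht => ?_⟩
  have h2 : HasDerivAt (fun t => (D t s).2)
      (fderiv ℝ (extendedField f g) (s, X t s) (D t s)).2 t :=
    (h.hasDerivAt_variation hH hI hs ht).snd
  have hDt : D t s = (1, (D t s).2) := Prod.ext (hfst t ht.le s hs) rfl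
  rw [hDt, fderiv_extendedField hf hg] at h2
  exact h2

/-- Solutions of an initial value problem for a `C¹` field are unique. -/
theorem IsSolution.unique {F : (Fin n → ℝ) → (Fin n → ℝ)} (hF : ContDiff ℝ 1 F)
    {x y : ℝ → (Fin n → ℝ)} (hx : IsSolution F x₀ x) (hy : IsSolution F x₀ y) {t : ℝ}
    (ht : 0 ≤ t) : x t = y t := by
  have hcx : ContinuousOn x (Icc 0 t) := fun u hu =>
    ((hx.2 u hu.1).continuousWithinAt).mono Icc_subset_Ici_self
  have hcy : ContinuousOn y (Icc 0 t) := fun u hu =>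
    ((hy.2 u hu.1).continuousWithinAt).mono Icc_subset_Ici_self
  -- A `C¹` field is only locally Lipschitz; on the compact union of the two trajectories it is
  -- Lipschitz.
  have hK : IsCompact (x '' Icc 0 t ∪ y '' Icc 0 t) :=
    (isCompact_Icc.image_of_continuousOn hcx).union (isCompact_Icc.image_of_continuousOn hcy)
  obtain ⟨L, hL⟩ := LocallyLipschitzOn.exists_lipschitzOnWith_of_compact hK
    (LocallyLipschitz.locallyLipschitzOn hF.locallyLipschitz)
  exact ODE_solution_unique_of_mem_Icc_right (v := fun _ => F)
    (s := fun _ => x '' Icc 0 t ∪ y '' Icc 0 t) (fun _ _ => hL) hcx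
    (fun u hu => (hx.2 u hu.1).mono (Ici_subset_Ici.2 hu.1))
    (fun u hu => Or.inl ⟨u, Ico_subset_Icc_self hu, rfl⟩) hcy
    (fun u hu => (hy.2 u hu.1).mono (Ici_subset_Ici.2 hu.1))
    (fun u hu => Or.inr ⟨u, Ico_subset_Icc_self hu, rfl⟩) (hx.1.trans hy.1.symm)
    (right_mem_Icc.2 ht)

theorem IsAuxSolution.eq_left (hf : ContDiff ℝ 1 f) (hX : IsAuxSolution f g x₀ x₀' X)
    {x : ℝ → (Fin n → ℝ)} (hx : IsSolution f x₀ x) {t : ℝ} (ht : 0 ≤ t) : X t 0 = x t := by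
  have h := hX 0 (left_mem_Icc.2 zero_le_one)
  have h0 : auxField f g 0 = f := by ext z i; simp [auxField]
  simp only [h0, sub_zero, one_smul, zero_smul, add_zero] at h
  exact h.unique hf hx ht

theorem IsAuxSolution.eq_right (hg : ContDiff ℝ 1 g) (hX : IsAuxSolution f g x₀ x₀' X)
    {x : ℝ → (Fin n → ℝ)} (hx : IsSolution g x₀' x) {t : ℝ} (ht : 0 ≤ t) : X t 1 = x t := by
  have h := hX 1 (right_mem_Icc.2 zero_le_one)
  have h0 : auxField f g 1 = g := by ext z i; simp [auxField, dynDiff]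
  simp only [h0, sub_self, one_smul, zero_smul, zero_add] at h
  exact h.unique hg hx ht

end Auxiliary

/-! ### Weighted norms, Cauchy–Schwarz and lengths of curves. -/

section WeightedNorm

variable {p : ℕ} {N : Matrix (Fin p) (Fin p) ℝ}

theorem weightedNorm_nonneg (N : Matrix (Fin p) (Fin p) ℝ) (v : Fin p → ℝ) :
    0 ≤ weightedNorm N v :=
  Real.sqrt_nonneg _

theorem weightedNorm_neg (N : Matrix (Fin p) (Fin p) ℝ) (v : Fin p → ℝ) :
    weightedNorm N (-v) = weightedNorm N v := by
  simp [weightedNorm, Matrix.mulVec_neg]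

theorem weightedNorm_sub_comm (N : Matrix (Fin p) (Fin p) ℝ) (v w : Fin p → ℝ) :
    weightedNorm N (v - w) = weightedNorm N (w - v) := by
  rw [← weightedNorm_neg, neg_sub]

theorem Matrix.PosSemidef.weightedNorm_mul_self (hN : N.PosSemidef) (v : Fin p → ℝ) :
    weightedNorm N v * weightedNorm N v = v ⬝ᵥ (N *ᵥ v) :=
  Real.mul_self_sqrt (by simpa using hN.dotProduct_mulVec_nonneg v)

theorem weightedNorm_mono {N' : Matrix (Fin p) (Fin p) ℝ} (h : (N' - N).PosSemidef)
    (v : Fin p → ℝ) : weightedNorm N v ≤ weightedNorm N' v := by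
  refine Real.sqrt_le_sqrt ?_
  have := h.dotProduct_mulVec_nonneg v
  simp only [star_trivial, Matrix.sub_mulVec, dotProduct_sub] at this
  linarith

theorem Matrix.PosSemidef.dotProduct_mulVec_comm (hN : N.PosSemidef) (v w : Fin p → ℝ) :
    v ⬝ᵥ (N *ᵥ w) = w ⬝ᵥ (N *ᵥ v) := by
  have hT : Nᵀ = N := by simpa using hN.isHermitian.eq
  rw [Matrix.dotProduct_mulVec, ← Matrix.mulVec_transpose, hT, dotProduct_comm]

/-- The Cauchy–Schwarz inequality for the form of a positive semidefinite matrix. -/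
theorem Matrix.PosSemidef.abs_dotProduct_mulVec_le (hN : N.PosSemidef) (v w : Fin p → ℝ) :
    |v ⬝ᵥ (N *ᵥ w)| ≤ weightedNorm N v * weightedNorm N w := by
  have hv : 0 ≤ v ⬝ᵥ (N *ᵥ v) := by simpa using hN.dotProduct_mulVec_nonneg v
  rw [weightedNorm, weightedNorm, ← Real.sqrt_mul hv]
  refine Real.abs_le_sqrt ?_
  -- The quadratic form at `x • v + w` is a nonnegative quadratic polynomial in `x`.
  have key := discrim_le_zero (a := v ⬝ᵥ (N *ᵥ v)) (b := 2 * (v ⬝ᵥ (N *ᵥ w)))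
    (c := w ⬝ᵥ (N *ᵥ w)) fun x => by
      have := hN.dotProduct_mulVec_nonneg (x • v + w)
      simp only [star_trivial, Matrix.mulVec_add, Matrix.mulVec_smul, dotProduct_add,
        add_dotProduct, smul_dotProduct, dotProduct_smul, smul_eq_mul,
        hN.dotProduct_mulVec_comm w v] at this
      linarith
  rw [discrim] at key
  linarith

theorem continuous_weightedNorm (N : Matrix (Fin p) (Fin p) ℝ) :
    Continuous (weightedNorm N) := by
  unfold weightedNorm
  fun_prop

/-- Convergence to zero in the norm of one positive definite matrix implies convergence to zero in
the norm of every matrix. -/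
theorem Matrix.PosDef.tendsto_weightedNorm_zero (hN : N.PosDef) (P : Matrix (Fin p) (Fin p) ℝ)
    {ι : Type*} {l : Filter ι} {v : ι → Fin p → ℝ}
    (h : Filter.Tendsto (fun i => weightedNorm N (v i)) l (nhds 0)) :
    Filter.Tendsto (fun i => weightedNorm P (v i)) l (nhds 0) := by
  have hv : Filter.Tendsto v l (nhds 0) := by
    refine tendsto_pi_nhds.2 fun j => ?_
    -- The `j`-th coordinate of `v` is its `N`-pairing with `N⁻¹ eⱼ`, so Cauchy–Schwarz bounds it.
    refine squeeze_zero_norm (a := fun i => weightedNorm N (v i) *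
      weightedNorm N (N⁻¹ *ᵥ Pi.single j 1)) (fun i => ?_) (by simpa using h.mul_const _)
    have := hN.posSemidef.abs_dotProduct_mulVec_le (v i) (N⁻¹ *ᵥ Pi.single j 1)
    rw [Matrix.mulVec_mulVec, Matrix.mul_nonsing_inv _ ((Matrix.isUnit_iff_isUnit_det N).1 hN.isUnit), Matrix.one_mulVec,
      dotProduct_single_one] at this
    exact this
  have h0 : weightedNorm P 0 = 0 := by simp [weightedNorm]
  simpa [h0, Function.comp_def] using ((continuous_weightedNorm P).tendsto 0).comp hv

/-- The norm of an increment is at most the length of the path. -/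
theorem Matrix.PosSemidef.weightedNorm_sub_le_integral (hN : N.PosSemidef)
    {y y' : ℝ → Fin p → ℝ} {ℓ : ℝ → ℝ}
    (hy : ∀ s ∈ Set.Icc (0 : ℝ) 1, HasDerivWithinAt y (y' s) (Set.Icc 0 1) s)
    (hy' : ContinuousOn y' (Set.Icc 0 1))
    (hℓ : IntervalIntegrable ℓ MeasureTheory.volume 0 1)
    (hle : ∀ s ∈ Set.Icc (0 : ℝ) 1, weightedNorm N (y' s) ≤ ℓ s) :
    weightedNorm N (y 1 - y 0) ≤ ∫ s in (0 : ℝ)..1, ℓ s := by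
  set v := y 1 - y 0 with hv
  -- Pairing the path with its own increment `v` gives `‖v‖² = ∫ φ(y') ≤ ‖v‖ ∫ ℓ`; then divide by
  -- `‖v‖` unless it is zero.
  let φ : (Fin p → ℝ) →L[ℝ] ℝ := (dotProductBilin ℝ ℝ v ∘ₗ N.mulVecLin).toContinuousLinearMap
  have hφ : ∀ w, φ w = v ⬝ᵥ (N *ᵥ w) := fun w => rfl
  have hint : IntervalIntegrable (fun s => φ (y' s)) MeasureTheory.volume 0 1 :=
    ContinuousOn.intervalIntegrable_of_Icc zero_le_one (φ.continuous.comp_continuousOn hy')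
  have hFTC : ∫ s in (0 : ℝ)..1, φ (y' s) = φ (y 1) - φ (y 0) := by
    refine intervalIntegral.integral_eq_sub_of_hasDerivAt_of_le (f := fun s => φ (y s))
      zero_le_one (φ.continuous.comp_continuousOn fun s hs => (hy s hs).continuousWithinAt)
      (fun s hs => ?_) hint
    exact φ.hasFDerivAt.comp_hasDerivAt s
      ((hy s (Set.Ioo_subset_Icc_self hs)).hasDerivAt (Icc_mem_nhds hs.1 hs.2))
  rw [← map_sub, hφ, ← hN.weightedNorm_mul_self] at hFTC
  have hmono : ∫ s in (0 : ℝ)..1, φ (y' s) ≤ ∫ s in (0 : ℝ)..1, weightedNorm N v * ℓ s := by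
    refine intervalIntegral.integral_mono_on zero_le_one hint (hℓ.const_mul _) fun s hs => ?_
    exact (le_abs_self _).trans ((hN.abs_dotProduct_mulVec_le v (y' s)).trans
      (mul_le_mul_of_nonneg_left (hle s hs) (weightedNorm_nonneg _ _)))
  rw [hFTC, intervalIntegral.integral_const_mul] at hmono
  rcases (weightedNorm_nonneg N v).eq_or_lt with h0 | h0
  · rw [← h0]
    exact intervalIntegral.integral_nonneg zero_le_one fun s hs =>
      (weightedNorm_nonneg _ _).trans (hle s hs)
  · exact le_of_mul_le_mul_left hmono h0

end WeightedNorm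

/-! ### Exponential decay of output tangent vectors. -/

section Contraction

open Set

variable {n p : ℕ}

/-- Entrywise derivatives match `matrixDeriv` and require no norm on matrices. -/
theorem HasDerivAt.dotProduct_mulVec {N : ℝ → Matrix (Fin n) (Fin n) ℝ}
    {N' : Matrix (Fin n) (Fin n) ℝ} {v : ℝ → Fin n → ℝ} {v' : Fin n → ℝ} {t : ℝ}
    (hN : ∀ i j, HasDerivAt (fun t => N t i j) (N' i j) t) (hv : HasDerivAt v v' t) :
    HasDerivAt (fun t => v t ⬝ᵥ (N t *ᵥ v t))
      (v' ⬝ᵥ (N t *ᵥ v t) + v t ⬝ᵥ (N' *ᵥ v t) + v t ⬝ᵥ (N t *ᵥ v')) t := by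
  have hv' := hasDerivAt_pi.1 hv
  have h : HasDerivAt (fun t => ∑ i, v t i * ∑ j, N t i j * v t j)
      (∑ i, (v' i * (∑ j, N t i j * v t j) + v t i * ∑ j, (N' i j * v t j + N t i j * v' j))) t :=
    HasDerivAt.fun_sum fun i _ => (hv' i).mul
      (HasDerivAt.fun_sum fun j _ => (hN i j).mul (hv' j))
  refine h.congr_deriv ?_
  simp only [dotProduct, Matrix.mulVec, Finset.sum_add_distrib, mul_add]
  ring

theorem jacobian_mulVec (F : (Fin n → ℝ) → (Fin n → ℝ)) (x v : Fin n → ℝ) :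
    jacobian F x *ᵥ v = fderiv ℝ F x v :=
  LinearMap.toMatrix'_mulVec _ v

theorem dotProduct_pullbackMetric_mulVec (C : Matrix (Fin p) (Fin n) ℝ)
    (M : (Fin n → ℝ) → Matrix (Fin p) (Fin p) ℝ) (x v w : Fin n → ℝ) :
    v ⬝ᵥ (pullbackMetric C M x *ᵥ w) = (C *ᵥ v) ⬝ᵥ (M x *ᵥ (C *ᵥ w)) := by
  rw [pullbackMetric, ← Matrix.mulVec_mulVec, ← Matrix.mulVec_mulVec, Matrix.dotProduct_mulVec,
    Matrix.vecMul_transpose]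

theorem differentiable_pullbackMetric (C : Matrix (Fin p) (Fin n) ℝ)
    {M : (Fin n → ℝ) → Matrix (Fin p) (Fin p) ℝ}
    (hM : ∀ i j, Differentiable ℝ (fun z => M z i j)) (i j : Fin n) :
    Differentiable ℝ (fun z => pullbackMetric C M z i j) := by
  simp only [pullbackMetric, Matrix.mul_apply]
  fun_prop

variable {f g : (Fin n → ℝ) → (Fin n → ℝ)} {C : Matrix (Fin p) (Fin n) ℝ}
  {M : (Fin n → ℝ) → Matrix (Fin p) (Fin p) ℝ} {μ s : ℝ}

/-- The contraction inequality, evaluated along a tangent vector. -/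
theorem ContractionLMI.le {x : Fin n → ℝ} (h : ContractionLMI f g C M μ s x)
    (hC : C *ᵥ dynDiff f g x = 0) (v : Fin n → ℝ) :
    let v' := fderiv ℝ f x v + s • fderiv ℝ (dynDiff f g) x v + dynDiff f g x
    v' ⬝ᵥ (pullbackMetric C M x *ᵥ v)
      + v ⬝ᵥ (matrixDeriv (pullbackMetric C M) x (auxField f g s x) *ᵥ v)
      + v ⬝ᵥ (pullbackMetric C M x *ᵥ v') ≤
      -2 * μ * (v ⬝ᵥ (pullbackMetric C M x *ᵥ v)) := by
  intro v'
  have hT : ∀ (A : Matrix (Fin n) (Fin n) ℝ) (w : Fin n → ℝ),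
      v ⬝ᵥ (Aᵀ *ᵥ w) = (A *ᵥ v) ⬝ᵥ w := fun A w => by
    rw [Matrix.dotProduct_mulVec, Matrix.vecMul_transpose]
  -- The forcing `Δ` meets `M_C` only through `CΔ = 0`, so what remains is the form in the matrix
  -- inequality.
  have h₁ : dynDiff f g x ⬝ᵥ (pullbackMetric C M x *ᵥ v) = 0 := by
    rw [dotProduct_pullbackMetric_mulVec, hC, zero_dotProduct]
  have h₂ : v ⬝ᵥ (pullbackMetric C M x *ᵥ dynDiff f g x) = 0 := by
    rw [dotProduct_pullbackMetric_mulVec, hC, Matrix.mulVec_zero, dotProduct_zero]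
  have := h.dotProduct_mulVec_nonneg v
  simp only [star_trivial, Matrix.sub_mulVec, Matrix.add_mulVec, Matrix.smul_mulVec,
    dotProduct_sub, dotProduct_add, dotProduct_smul, ← Matrix.mulVec_mulVec, hT,
    jacobian_mulVec, smul_eq_mul] at this
  simp only [v', add_dotProduct, smul_dotProduct, Matrix.mulVec_add, Matrix.mulVec_smul,
    dotProduct_add, dotProduct_smul, smul_eq_mul, h₁, h₂]
  linarith

/-- Along a solution of the auxiliary system, the weighted norm of the output of a tangent vector
decays exponentially. -/
theorem weightedNorm_tangent_le (hM : ∀ i j, Differentiable ℝ (fun z => M z i j))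
    {x δ : ℝ → Fin n → ℝ}
    (hx : ∀ t, 0 ≤ t → HasDerivWithinAt x (auxField f g s (x t)) (Ici 0) t)
    (hδ : ∀ T, ContinuousOn δ (Icc 0 T))
    (hδ' : ∀ t, 0 < t → HasDerivAt δ (fderiv ℝ f (x t) (δ t)
      + s • fderiv ℝ (dynDiff f g) (x t) (δ t) + dynDiff f g (x t)) t)
    (hLMI : ∀ t, 0 ≤ t → ContractionLMI f g C M μ s (x t))
    (hC : ∀ t, 0 ≤ t → C *ᵥ dynDiff f g (x t) = 0) {t : ℝ} (ht : 0 ≤ t) :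
    weightedNorm (M (x t)) (C *ᵥ δ t) ≤
      Real.exp (-μ * t) * weightedNorm (M (x 0)) (C *ᵥ δ 0) := by
  set V : ℝ → ℝ := fun t => δ t ⬝ᵥ (pullbackMetric C M (x t) *ᵥ δ t) with hV
  have hdiff := differentiable_pullbackMetric C hM
  have hVc : ContinuousOn V (Icc 0 t) := by
    have hxc : ContinuousOn x (Icc 0 t) := fun u hu =>
      ((hx u hu.1).continuousWithinAt).mono Icc_subset_Ici_self
    have hδi := continuousOn_pi.1 (hδ t)
    have hV' : V = fun t => ∑ i, δ t i * ∑ j, pullbackMetric C M (x t) i j * δ t j := rfl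
    rw [hV']
    exact continuousOn_finsetSum _ fun i _ => (hδi i).mul (continuousOn_finsetSum _
      fun j _ => ((hdiff i j).continuous.comp_continuousOn hxc).mul (hδi j))
  -- Derivatives at interior times suffice; continuity of `V` handles the initial time.
  have hVd : ∀ u, 0 < u → ∃ V', HasDerivAt V V' u ∧ V' ≤ -2 * μ * V u := by
    intro u hu
    refine ⟨_, HasDerivAt.dotProduct_mulVec
      (N' := matrixDeriv (pullbackMetric C M) (x u) (auxField f g s (x u))) (fun i j => ?_)
      (hδ' u hu), (hLMI u hu.le).le (hC u hu.le) (δ u)⟩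
    exact ((hdiff i j) (x u)).hasFDerivAt.comp_hasDerivAt u
      ((hx u hu.le).hasDerivAt (Ici_mem_nhds hu))
  have hexp : ∀ u, HasDerivAt (fun u => Real.exp (2 * μ * u)) (Real.exp (2 * μ * u) * (2 * μ)) u :=
    fun u => by simpa using ((hasDerivAt_id u).const_mul (2 * μ)).exp
  -- With the integrating factor, `V' ≤ -2μV` says that `e^{2μu} V` has nonpositive derivative.
  have hanti : AntitoneOn (fun u => Real.exp (2 * μ * u) * V u) (Icc 0 t) := by
    refine antitoneOn_of_deriv_nonpos (convex_Icc 0 t)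
      (ContinuousOn.mul (by fun_prop) hVc) (fun u hu => ?_) (fun u hu => ?_)
    all_goals
      rw [interior_Icc] at hu
      obtain ⟨V', hV', hle⟩ := hVd u hu.1
      have hd := (hexp u).mul hV'
    · exact hd.differentiableAt.differentiableWithinAt
    · rw [show (fun u => Real.exp (2 * μ * u) * V u) = (fun u => Real.exp (2 * μ * u)) * V from rfl,
        hd.deriv]
      have := mul_le_mul_of_nonneg_left hle (Real.exp_pos (2 * μ * u)).le
      linarith
  have hle := hanti (left_mem_Icc.2 ht) (right_mem_Icc.2 ht) ht
  simp only [mul_zero, Real.exp_zero, one_mul] at hle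
  have hVt : V t ≤ Real.exp (-μ * t) ^ 2 * V 0 := by
    have h2 : Real.exp (-μ * t) ^ 2 * Real.exp (2 * μ * t) = 1 := by
      rw [← Real.exp_nat_mul, ← Real.exp_add, ← Real.exp_zero]
      congr 1
      push_cast
      ring
    calc V t = Real.exp (-μ * t) ^ 2 * (Real.exp (2 * μ * t) * V t) := by
          rw [← mul_assoc, h2, one_mul]
      _ ≤ _ := by gcongr
  rw [weightedNorm, weightedNorm, ← dotProduct_pullbackMetric_mulVec,
    ← dotProduct_pullbackMetric_mulVec]
  calc √(V t) ≤ √(Real.exp (-μ * t) ^ 2 * V 0) := Real.sqrt_le_sqrt hVt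
    _ = Real.exp (-μ * t) * √(V 0) := by
      rw [Real.sqrt_mul (by positivity), Real.sqrt_sq (Real.exp_pos _).le]

theorem HasDerivWithinAt.matrix_mulVec {y : ℝ → Fin n → ℝ} {y' : Fin n → ℝ} {S : Set ℝ} {t : ℝ}
    (C : Matrix (Fin p) (Fin n) ℝ) (h : HasDerivWithinAt y y' S t) :
    HasDerivWithinAt (fun t => C *ᵥ y t) (C *ᵥ y') S t :=
  (C.mulVecLin.toContinuousLinearMap).hasFDerivAt.comp_hasDerivWithinAt t h

end Contraction

/-! ### Contraction of the observed length and its consequences. -/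

theorem corollary2 {n p : ℕ} (f g : (Fin n → ℝ) → (Fin n → ℝ))
    (hf : ContDiff ℝ 1 f) (hg : ContDiff ℝ 1 g)
    (C : Matrix (Fin p) (Fin n) ℝ)
    (M : (Fin n → ℝ) → Matrix (Fin p) (Fin p) ℝ)
    (hMpos : ∀ z, (M z).PosDef)
    (hMdiff : ∀ i j, Differentiable ℝ (fun z => M z i j))
    (μ : ℝ) (hμ : 0 < μ)
    (x₀ x₀' : Fin n → ℝ)
    (x x' : ℝ → (Fin n → ℝ)) (hx : IsSolution f x₀ x) (hx' : IsSolution g x₀' x')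
    (X : ℝ → ℝ → (Fin n → ℝ)) (hX : IsAuxSolution f g x₀ x₀' X)
    (hLMI : ∀ t : ℝ, 0 ≤ t → ∀ s ∈ Set.Icc (0 : ℝ) 1, ContractionLMI f g C M μ s (X t s))
    (hCΔ : ∀ t : ℝ, 0 ≤ t → ∀ s ∈ Set.Icc (0 : ℝ) 1, C *ᵥ dynDiff f g (X t s) = 0) :
    -- the length is well defined
    (∀ t : ℝ, 0 ≤ t →
      ContDiffOn ℝ 1 (fun s => C *ᵥ X t s) (Set.Icc 0 1) ∧
      IntervalIntegrable (fun s => weightedNorm (M (X t s)) (outputTangent C X t s))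
        MeasureTheory.volume 0 1) ∧
    -- the length contracts with rate `μ`
    (∀ t : ℝ, 0 ≤ t →
      observedLength C M X t ≤ Real.exp (-μ * t) * observedLength C M X 0) ∧
    -- if `M` is bounded below by a constant positive definite matrix, the measurements contract
    -- to each other with rate `μ` and become indistinguishable
    (∀ N : Matrix (Fin p) (Fin p) ℝ, N.PosDef →
      (∀ t : ℝ, 0 ≤ t → ∀ s ∈ Set.Icc (0 : ℝ) 1, (M (X t s) - N).PosSemidef) →
      (∀ t : ℝ, 0 ≤ t →
        weightedNorm N (C *ᵥ x t - C *ᵥ x' t) ≤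
          Real.exp (-μ * t) * observedLength C M X 0) ∧
      (∀ P : Matrix (Fin p) (Fin p) ℝ, P.PosDef →
        BecomeIndistinguishable P (fun t => C *ᵥ x t) (fun t => C *ᵥ x' t))) ∧
    -- for a constant `M`, the contraction estimate in the norm of `M`
    (∀ M₀ : Matrix (Fin p) (Fin p) ℝ, (∀ z, M z = M₀) → ∀ t : ℝ, 0 ≤ t →
      weightedNorm M₀ (C *ᵥ x t - C *ᵥ x' t) ≤
        Real.exp (-μ * t) * weightedNorm M₀ (C *ᵥ x₀ - C *ᵥ x₀')) := by
  obtain ⟨δ, hδ, hδs, hδt, hδ'⟩ := hX.exists_tangent hf hg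
  have hI : UniqueDiffOn ℝ (Set.Icc (0 : ℝ) 1) := uniqueDiffOn_Icc one_pos
  have hy : ∀ t, 0 ≤ t → ∀ s ∈ Set.Icc (0 : ℝ) 1,
      HasDerivWithinAt (fun s => C *ᵥ X t s) (C *ᵥ δ t s) (Set.Icc 0 1) s :=
    fun t ht s hs => (hδ t ht s hs).matrix_mulVec C
  have htan : ∀ t, 0 ≤ t → ∀ s ∈ Set.Icc (0 : ℝ) 1, outputTangent C X t s = C *ᵥ δ t s :=
    fun t ht s hs => (hy t ht s hs).derivWithin (hI s hs)
  have hyc : ∀ t, 0 ≤ t → ContinuousOn (fun s => C *ᵥ δ t s) (Set.Icc 0 1) := fun t ht =>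
    (C.mulVecLin.toContinuousLinearMap).continuous.comp_continuousOn (hδs t ht)
  have hMc : Continuous M := continuous_matrix fun i j => (hMdiff i j).continuous
  have hwc : ∀ t, 0 ≤ t → ContinuousOn
      (fun s => weightedNorm (M (X t s)) (outputTangent C X t s)) (Set.Icc 0 1) := by
    intro t ht
    have hXc : ContinuousOn (X t) (Set.Icc 0 1) := fun s hs => (hδ t ht s hs).continuousWithinAt
    have hc : Continuous fun q : (Fin n → ℝ) × (Fin p → ℝ) => weightedNorm (M q.1) q.2 := by
      unfold weightedNorm
      fun_prop
    exact hc.comp_continuousOn (hXc.prodMk ((hyc t ht).congr (htan t ht)))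
  have hint : ∀ t, 0 ≤ t → IntervalIntegrable
      (fun s => weightedNorm (M (X t s)) (outputTangent C X t s)) MeasureTheory.volume 0 1 :=
    fun t ht => (hwc t ht).intervalIntegrable_of_Icc zero_le_one
  have hdecay : ∀ t, 0 ≤ t →
      observedLength C M X t ≤ Real.exp (-μ * t) * observedLength C M X 0 := by
    intro t ht
    rw [observedLength, observedLength, ← intervalIntegral.integral_const_mul]
    refine intervalIntegral.integral_mono_on zero_le_one (hint t ht)
      ((hint 0 le_rfl).const_mul _) fun s hs => ?_
    rw [htan t ht s hs, htan 0 le_rfl s hs]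
    exact weightedNorm_tangent_le (x := fun t => X t s) (δ := fun t => δ t s) hMdiff (hX s hs).2
      (hδt s hs) (hδ' s hs) (fun t ht => hLMI t ht s hs) (fun t ht => hCΔ t ht s hs) ht
  have hbound : ∀ N : Matrix (Fin p) (Fin p) ℝ, N.PosDef →
      (∀ t : ℝ, 0 ≤ t → ∀ s ∈ Set.Icc (0 : ℝ) 1, (M (X t s) - N).PosSemidef) → ∀ t : ℝ, 0 ≤ t →
        weightedNorm N (C *ᵥ x t - C *ᵥ x' t) ≤
          Real.exp (-μ * t) * observedLength C M X 0 := by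
    intro N hN hle t ht
    refine le_trans ?_ (hdecay t ht)
    -- Uniqueness identifies the two outputs with the ends `s = 0` and `s = 1` of the output curve.
    rw [← hX.eq_left hf hx ht, ← hX.eq_right hg hx' ht, weightedNorm_sub_comm]
    refine hN.posSemidef.weightedNorm_sub_le_integral (hy t ht) (hyc t ht) (hint t ht)
      fun s hs => ?_
    rw [htan t ht s hs]
    exact weightedNorm_mono (hle t ht s hs) _
  refine ⟨fun t ht => ⟨(contDiffOn_one_iff_derivWithin hI).2
    ⟨fun s hs => (hy t ht s hs).differentiableWithinAt, (hyc t ht).congr (htan t ht)⟩,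
    hint t ht⟩, hdecay, fun N hN hle => ⟨hbound N hN hle, fun P _ ε hε => ?_⟩,
    fun M₀ hM₀ t ht => ?_⟩
  · have hexp : Filter.Tendsto (fun t => Real.exp (-μ * t) * observedLength C M X 0)
        Filter.atTop (nhds 0) := by
      have h : Filter.Tendsto (fun t : ℝ => Real.exp (-μ * t)) Filter.atTop (nhds 0) :=
        Real.tendsto_exp_atBot.comp
          (Filter.tendsto_id.const_mul_atTop_of_neg (neg_lt_zero.2 hμ))
      simpa using h.mul_const (observedLength C M X 0)
    have hN0 : Filter.Tendsto (fun t => weightedNorm N (C *ᵥ x t - C *ᵥ x' t))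
        Filter.atTop (nhds 0) :=
      squeeze_zero' (Filter.Eventually.of_forall fun t => weightedNorm_nonneg _ _)
        ((Filter.eventually_ge_atTop 0).mono fun t ht => hbound N hN hle t ht) hexp
    obtain ⟨T, hT⟩ := Filter.eventually_atTop.1
      ((hN.tendsto_weightedNorm_zero P hN0).eventually (gt_mem_nhds hε))
    exact ⟨max T 1, lt_max_of_lt_right one_pos, fun t ht => hT t ((le_max_left _ _).trans ht.le)⟩
  · have hM₀pos : M₀.PosDef := hM₀ 0 ▸ hMpos 0
    -- At time zero the curve is a segment with constant velocity, so with constant `M` the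
    -- integrand is constant.
    have hL : observedLength C M X 0 = weightedNorm M₀ (C *ᵥ x₀ - C *ᵥ x₀') := by
      have hconst : ∀ s ∈ Set.uIcc (0 : ℝ) 1, weightedNorm (M (X 0 s)) (outputTangent C X 0 s) =
          weightedNorm M₀ (C *ᵥ x₀ - C *ᵥ x₀') := by
        intro s hs
        rw [Set.uIcc_of_le zero_le_one] at hs
        have hline : HasDerivWithinAt (fun s : ℝ => (1 - s) • x₀ + s • x₀') (x₀' - x₀)
            (Set.Icc 0 1) s := by
          have h1 := ((hasDerivWithinAt_id s (Set.Icc (0 : ℝ) 1)).const_sub 1).smul_const x₀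
          have h2 := (hasDerivWithinAt_id s (Set.Icc (0 : ℝ) 1)).smul_const x₀'
          exact (h1.fun_add h2).congr_deriv (by simp [sub_eq_neg_add])
        have hX0 : HasDerivWithinAt (X 0) (x₀' - x₀) (Set.Icc 0 1) s :=
          hline.congr (fun s hs => (hX s hs).1) (hX s hs).1
        rw [hM₀, htan 0 le_rfl s hs, (hI s hs).eq_deriv _ (hδ 0 le_rfl s hs) hX0,
          Matrix.mulVec_sub, weightedNorm_sub_comm]
      rw [observedLength, intervalIntegral.integral_congr hconst]
      simp
    rw [← hL]
    refine hbound M₀ hM₀pos (fun t _ s _ => ?_) t ht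
    rw [hM₀, sub_self]
    exact Matrix.PosSemidef.zero
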